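/- Let $\Bbbk$ be a field and let $a,b,c\ge 0$ be integers. Let $L(a,b,c)$ be the graph with vertex set $\{x,y\}\cup\{x_i\}_{i=1}^a\cup\{y_j\}_{j=1}^b\cup\{z_k\}_{k=1}^c$ and edge set $\{\{x,y\}\}\cup\{\{x,x_i\}\}_{i=1}^a\cup\{\{y,y_j\}\}_{j=1}^b\cup\{\{x,z_k\},\{y,z_k\}\}_{k=1}^c$. Let $Q$ be the polynomial ring over $\Bbbk$ whose variables are these vertices, and let $I=I_{L(a,b,c)}\subseteq Q$ be the edge ideal, generated by the products $vw$ over the edges $\{v,w\}$. Let $G(I)$ be the set of minimal monomial generators of $I$. For a total order $<$ on $G(I)$, the Taylor resolution $\mathbb{T}$ is the complex of free $Q$-modules with basis elements $e_U$ in degree $|U|$, for $U\subseteq G(I)$, and differential $$\partial(e_U)=\sum_{u\in U}(-1)^{|\{v\in U\,:\,v<u\}|}\,\frac{m_U}{m_{U\smallsetminus\{u\}}}\,e_{U\smallsetminus\{u\}},\qquad m_U=\operatorname{lcm}(U).$$ The Lyubeznik resolution $\mathbb{L}_<$ is the subcomplex of $\mathbb{T}$ generated by the $e_U$ such that, for every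 $t\in U$ with $t\neq\max U$ and every $q\in G(I)$ with $q<t$, the monomial $q$ does not divide $\operatorname{lcm}\{v\in U: v\ge t\}$. Theorem. For every total order $<$ on $G(I)$ in which $xy$ is the least element, $\mathbb{L}_<$ is the minimal graded free resolution of $Q/I$ over $Q$. That is, $\mathbb{L}_<$ is a graded free resolution of $Q/I$ by free modules of finite rank, and $\partial(\mathbb{L}_<)\subseteq\mathfrak{m}\mathbb{L}_<$, where $\mathfrak{m}$ is the ideal generated by the variables. -/

import Mathlib

open MvPolynomial CategoryTheory

noncomputable section

/-! ### Graphs `L(a,b,c)` and edge ideals -/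

/-- The vertices `x`, `y`, `x_i` (`i < a`), `y_j` (`j < b`), `z_k` (`k < c`) of `L(a,b,c)`. -/
inductive LVertex (a b c : ℕ) : Type
  | x : LVertex a b c
  | y : LVertex a b c
  | xs (i : Fin a) : LVertex a b c
  | ys (j : Fin b) : LVertex a b c
  | zs (k : Fin c) : LVertex a b c

/-- The graph `L(a,b,c)`: its edges are `{x,y}`, the `{x,x_i}`, the `{y,y_j}`, and both
`{x,z_k}` and `{y,z_k}` for every `k`. -/
def LGraph (a b c : ℕ) : SimpleGraph (LVertex a b c) :=
  SimpleGraph.fromEdgeSet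
    ({s(LVertex.x, LVertex.y)}
      ∪ Set.range (fun i : Fin a => s(LVertex.x, LVertex.xs i))
      ∪ Set.range (fun j : Fin b => s(LVertex.y, LVertex.ys j))
      ∪ Set.range (fun k : Fin c => s(LVertex.x, LVertex.zs k))
      ∪ Set.range (fun k : Fin c => s(LVertex.y, LVertex.zs k)))

/-- The edge ideal of a graph `G` on `V` in the polynomial ring `K[V]`. -/
def edgeIdeal (K : Type*) [Field K] {V : Type*} (G : SimpleGraph V) : Ideal (MvPolynomial V K) :=
  Ideal.span {p | ∃ v w : V, G.Adj v w ∧ p = X v * X w}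

/-! ### Minimal monomial generators -/

/-- `MinGen I` is the set `G(I)` of minimal monomial generators of a monomial ideal `I`: the
monomials in `I` (given by their exponent vectors) that are minimal under divisibility.  On exponent
vectors, divisibility is `≤` and the least common multiple is `⊔`.  A structure is used so that
`MinGen I` carries no order other than the total order one chooses on it. -/
@[ext]
structure MinGen {V K : Type*} [Field K] (I : Ideal (MvPolynomial V K)) where
  /-- the exponent vector of the generator -/
  exponent : V →₀ ℕ
  minimal : Minimal (fun m : V →₀ ℕ => monomial m (1 : K) ∈ I) exponent

section Complexes

variable {V K : Type*} [Field K] (I : Ideal (MvPolynomial V K))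

/-- The exponent vector of `m_U`, the least common multiple of the generators in `U`. -/
def lcmExp {I : Ideal (MvPolynomial V K)} (U : Finset (MinGen I)) : V →₀ ℕ :=
  U.sup MinGen.exponent

/-! ### The Taylor resolution -/

/-- The Taylor resolution, as the direct sum of its components: the free module with basis
the `e_U`, for `U` a finite subset of `G(I)`.  Here `e_U` is `Finsupp.single U 1`, and it sits in
homological degree `U.card`. -/
abbrev Taylor : Type _ := Finset (MinGen I) →₀ MvPolynomial V K

variable [LinearOrder (MinGen I)]

variable {I} in
/-- The coefficient `(-1)^{σ(u,U)} m_U / m_{U \ u}`, where `σ(u,U)` is the number of `v ∈ U` with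
`v < u`. -/
def taylorCoeff (U : Finset (MinGen I)) (u : MinGen I) : MvPolynomial V K :=
  (-1) ^ (U.filter (fun v => v < u)).card * monomial (lcmExp U - lcmExp (U.erase u)) 1

/-- The Taylor differential, `∂ e_U = ∑_{u ∈ U} (-1)^{σ(u,U)} (m_U / m_{U \ u}) e_{U \ u}`. -/
def taylorD : Taylor I →ₗ[MvPolynomial V K] Taylor I :=
  Finsupp.linearCombination (MvPolynomial V K)
    (fun U => ∑ u ∈ U, Finsupp.single (U.erase u) (taylorCoeff U u))

lemma taylorD_single (U : Finset (MinGen I)) (p : MvPolynomial V K) :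
    taylorD I (Finsupp.single U p)
      = p • ∑ u ∈ U, Finsupp.single (U.erase u) (taylorCoeff U u) := by
  simp [taylorD, Finsupp.linearCombination_single]

variable {I} in
lemma taylorCoeff_mul_of_lt (U : Finset (MinGen I)) {u v : MinGen I} (hu : u ∈ U)
    (huv : u < v) :
    taylorCoeff U u * taylorCoeff (U.erase u) v
      + taylorCoeff U v * taylorCoeff (U.erase v) u = 0 := by
  have mono : ∀ (W : Finset (MinGen I)) (w : MinGen I), lcmExp (W.erase w) ≤ lcmExp W :=
    fun W w => Finset.sup_mono (Finset.erase_subset _ _)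
  have h1 : ((U.erase v).filter (fun w => w < u)) = U.filter (fun w => w < u) := by
    ext w
    simp only [Finset.mem_filter, Finset.mem_erase]
    exact ⟨fun h => ⟨h.1.2, h.2⟩, fun h => ⟨⟨(h.2.trans huv).ne, h.1⟩, h.2⟩⟩
  have h2 : ((U.erase u).filter (fun w => w < v)).card + 1 = (U.filter (fun w => w < v)).card := by
    rw [Finset.filter_erase]
    exact Finset.card_erase_add_one (by simp [hu, huv])
  have key : ∀ (w w' : MinGen I),
      (monomial (lcmExp U - lcmExp (U.erase w)) (1 : K)) *
        monomial (lcmExp (U.erase w) - lcmExp ((U.erase w).erase w')) 1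
      = monomial (lcmExp U - lcmExp ((U.erase w).erase w')) 1 := by
    intro w w'
    rw [monomial_mul, one_mul, tsub_add_tsub_cancel (mono _ _) (mono _ _)]
  have key' := key v u
  rw [Finset.erase_right_comm] at key'
  simp only [taylorCoeff, h1, ← h2, Finset.erase_right_comm (a := v) (b := u)]
  rw [pow_succ]
  linear_combination ((-1) ^ (U.filter (fun w => w < u)).card *
    (-1) ^ ((U.erase u).filter (fun w => w < v)).card) * (key u v - key')

lemma taylorD_taylorD (z : Taylor I) : taylorD I (taylorD I z) = 0 := by
  induction z using Finsupp.induction_linear with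
  | zero => simp
  | add f g hf hg => simp [hf, hg]
  | single U p =>
    rw [taylorD_single, map_smul, map_sum]
    simp only [taylorD_single, Finset.smul_sum, Finsupp.smul_single, smul_eq_mul]
    rw [Finset.sum_sigma']
    refine Finset.sum_involution (fun q _ => ⟨q.2, q.1⟩) ?_ ?_ ?_ ?_
    · rintro ⟨u, v⟩ h
      simp only [Finset.mem_sigma, Finset.mem_erase] at h
      rw [Finset.erase_right_comm (a := v) (b := u), ← Finsupp.single_add, ← mul_add]
      rcases lt_or_gt_of_ne h.2.1 with hlt | hlt
      · rw [add_comm, taylorCoeff_mul_of_lt U h.2.2 hlt]; simp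
      · rw [taylorCoeff_mul_of_lt U h.1 hlt]; simp
    · rintro ⟨u, v⟩ h _ heq
      simp only [Finset.mem_sigma, Finset.mem_erase] at h
      simp only [Sigma.mk.injEq, heq_eq_eq] at heq
      exact h.2.1 heq.1
    · rintro ⟨u, v⟩ h
      simp only [Finset.mem_sigma, Finset.mem_erase] at h ⊢
      exact ⟨h.2.2, h.2.1.symm, h.1⟩
    · intros; rfl

/-! ### The Lyubeznik resolution -/

variable {I} in
/-- The admissible sets `U = {u_{i_1} < ⋯ < u_{i_s}}`: for every `t` in `U` other than the largest
element of `U`, no generator `q < t` divides the least common multiple of the elements of `U` that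
are at least `t`. -/
def LyubeznikAdmissible (U : Finset (MinGen I)) : Prop :=
  ∀ t ∈ U, (∃ s ∈ U, t < s) → ∀ q : MinGen I, q < t →
    ¬ q.exponent ≤ lcmExp (U.filter (fun v => t ≤ v))

/-- The degree `n` part of the Lyubeznik resolution: the submodule of the Taylor resolution
generated by the `e_U` with `U` admissible of cardinality `n`. -/
def lyubeznikModule (n : ℕ) : Submodule (MvPolynomial V K) (Taylor I) :=
  Submodule.span (MvPolynomial V K)
    ((fun U => Finsupp.single U 1) '' {U : Finset (MinGen I) | U.card = n ∧ LyubeznikAdmissible U})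

variable {I} in
lemma LyubeznikAdmissible.subset {U W : Finset (MinGen I)} (hU : LyubeznikAdmissible U)
    (h : W ⊆ U) : LyubeznikAdmissible W := by
  rintro t ht ⟨s, hs, hts⟩ q hq hle
  exact hU t (h ht) ⟨s, h hs, hts⟩ q hq
    (hle.trans (Finset.sup_mono (Finset.filter_subset_filter _ h)))

lemma taylorD_mem_lyubeznikModule (n : ℕ) (z : Taylor I) (hz : z ∈ lyubeznikModule I (n + 1)) :
    taylorD I z ∈ lyubeznikModule I n := by
  suffices h : lyubeznikModule I (n + 1) ≤ (lyubeznikModule I n).comap (taylorD I) from h hz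
  rw [lyubeznikModule, Submodule.span_le]
  rintro _ ⟨U, ⟨hc, hU⟩, rfl⟩
  simp only [SetLike.mem_coe, Submodule.mem_comap, taylorD_single, one_smul]
  refine Submodule.sum_mem _ fun u hu => ?_
  have : (Finsupp.single (U.erase u) (taylorCoeff U u) : Taylor I)
      = taylorCoeff U u • Finsupp.single (U.erase u) 1 := by simp
  rw [this]
  refine Submodule.smul_mem _ _ (Submodule.subset_span ⟨U.erase u, ⟨?_, ?_⟩, rfl⟩)
  · rw [Finset.card_erase_of_mem hu, hc]; rfl
  · exact hU.subset (Finset.erase_subset _ _)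

/-- The differential of the Lyubeznik resolution: the restriction of the Taylor differential. -/
def lyubeznikD (n : ℕ) :
    lyubeznikModule I (n + 1) →ₗ[MvPolynomial V K] lyubeznikModule I n :=
  (taylorD I).restrict (taylorD_mem_lyubeznikModule I n)

/-- The Lyubeznik resolution of `K[V] / I` for the given total order on `G(I)`, as a chain complex
(a subcomplex of the Taylor resolution). -/
def lyubeznikComplex : ChainComplex (ModuleCat (MvPolynomial V K)) ℕ :=
  ChainComplex.of (fun n => ModuleCat.of _ (lyubeznikModule I n))
    (fun n => ModuleCat.ofHom (lyubeznikD I n)) (by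
      intro n
      refine ModuleCat.hom_ext (LinearMap.ext fun z => Subtype.ext ?_)
      exact taylorD_taylorD I z.1)

end Complexes

/-! ### Minimal free resolutions -/

/-- The complex `C` is a minimal (graded) free resolution of `K[V] / I` over `K[V]`, for
the standard grading of `K[V]`.  That is, `C` consists of free modules of finite rank; it is exact
in positive degrees and has an augmentation `ε` onto `K[V] / I` with kernel the image of `C₁`;
for suitable bases and degrees of the basis elements, the differentials and the augmentation are
homogeneous of degree zero; and the differential maps `C` into `𝔪 C`, where `𝔪` is the ideal
generated by the variables. -/
structure IsMinimalFreeResolution {V K : Type*} [Field K]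
    (C : ChainComplex (ModuleCat (MvPolynomial V K)) ℕ) (I : Ideal (MvPolynomial V K)) : Prop where
  exact : ∀ n : ℕ, Function.Exact (C.d (n + 2) (n + 1)) (C.d (n + 1) n)
  free : ∃ (r : ℕ → ℕ) (b : ∀ n, Module.Basis (Fin (r n)) (MvPolynomial V K) (C.X n))
      (deg : ∀ n, Fin (r n) → ℕ) (ε : C.X 0 →ₗ[MvPolynomial V K] (MvPolynomial V K ⧸ I)),
    Function.Surjective ε ∧ Function.Exact (C.d 1 0) ε ∧
    (∀ i, ∃ p : MvPolynomial V K, p.IsHomogeneous (deg 0 i) ∧ ε (b 0 i) = Ideal.Quotient.mk I p) ∧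
    (∀ n j i, ∀ m ∈ ((b n).repr (C.d (n + 1) n (b (n + 1) j)) i).support,
      m.degree + deg n i = deg (n + 1) j)
  minimal : ∀ (n : ℕ) (z : C.X (n + 1)),
    C.d (n + 1) n z ∈ (Ideal.span (Set.range (X : V → MvPolynomial V K))) •
      (⊤ : Submodule (MvPolynomial V K) (C.X n))

end

/-! Exactness holds for every order. In a fixed multidegree `m` the Taylor complex is the simplicial
chain complex on the generators dividing `x^m`, and coning with the least of these, `q`, contracts
it (`taylorMonomial_homotopy`). The cone preserves admissibility
(`LyubeznikAdmissible.insert_isLeast`), so it restricts to the Lyubeznik subcomplex and contracts it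
too.

Minimality is where `L(a,b,c)` and the order enter. As `xy` is least, admissibility of `U` prevents
`xy` from dividing the lcm of the other members of `U`
(`LyubeznikAdmissible.not_exponent_le_lcmExp_erase`). Every other generator is `xt` or `yt`, so
those in `U` all use `x` or all use `y`. Each then has a variable `t` of its own, and deleting any
member strictly lowers the lcm (`LyubeznikAdmissible.lcmExp_erase_ne`). Hence no differential
coefficient is a unit. -/

/-! ### Contracting homotopy by coning with the least generator. -/

section Homotopy

variable {V K : Type*} [Field K] {I : Ideal (MvPolynomial V K)}

lemma MinGen.exponent_le_lcmExp {U : Finset (MinGen I)} {u : MinGen I} (hu : u ∈ U) :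
    u.exponent ≤ lcmExp U :=
  Finset.le_sup (f := MinGen.exponent) hu

lemma lcmExp_mono {U W : Finset (MinGen I)} (h : U ⊆ W) : lcmExp U ≤ lcmExp W :=
  Finset.sup_mono h

lemma MinGen.exponent_le_iff {u v : MinGen I} : u.exponent ≤ v.exponent ↔ u = v := by
  refine ⟨fun h => MinGen.ext (le_antisymm h (v.minimal.2 u.minimal.1 h)), fun h => h ▸ le_rfl⟩

lemma exists_minGen_le {m : V →₀ ℕ} (hm : monomial m (1 : K) ∈ I) :
    ∃ q : MinGen I, q.exponent ≤ m := by
  obtain ⟨e, he, hmin⟩ :=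
    exists_minimal_le_of_wellFoundedLT (fun m : V →₀ ℕ => monomial m (1 : K) ∈ I) m hm
  exact ⟨⟨e, hmin⟩, he⟩

/-- The element `x^(m - m_U) e_U` of multidegree `m` of the Taylor resolution. -/
noncomputable def taylorMonomial (U : Finset (MinGen I)) (m : V →₀ ℕ) : Taylor I :=
  Finsupp.single U (monomial (m - lcmExp U) 1)

lemma single_monomial_eq_smul_taylorMonomial (U : Finset (MinGen I)) (m : V →₀ ℕ) (r : K) :
    (Finsupp.single U (monomial m r) : Taylor I) = r • taylorMonomial U (m + lcmExp U) := by
  rw [taylorMonomial, add_tsub_cancel_right, Finsupp.smul_single, smul_monomial, smul_eq_mul,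
    mul_one]

lemma single_eq_sum_taylorMonomial (U : Finset (MinGen I)) (p : MvPolynomial V K) :
    (Finsupp.single U p : Taylor I) =
      ∑ m ∈ p.support, p.coeff m • taylorMonomial U (m + lcmExp U) := by
  conv_lhs => rw [← support_sum_monomial_coeff p]
  rw [← Finsupp.singleAddHom_apply, map_sum]
  simp only [Finsupp.singleAddHom_apply, single_monomial_eq_smul_taylorMonomial]

variable [LinearOrder (MinGen I)]

/-- In a fixed multidegree the monomial coefficients telescope away, leaving the signed simplicial
boundary. -/
lemma taylorD_taylorMonomial {U : Finset (MinGen I)} {m : V →₀ ℕ} (h : lcmExp U ≤ m) :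
    taylorD I (taylorMonomial U m) =
      ∑ u ∈ U, ((-1 : K) ^ (U.filter (fun v => v < u)).card) • taylorMonomial (U.erase u) m := by
  rw [taylorMonomial, taylorD_single, Finset.smul_sum]
  refine Finset.sum_congr rfl fun u _ => ?_
  have hle : lcmExp (U.erase u) ≤ lcmExp U := lcmExp_mono (Finset.erase_subset _ _)
  rw [taylorMonomial, taylorCoeff, Finsupp.smul_single, Finsupp.smul_single, smul_eq_mul,
    ← tsub_add_tsub_cancel h hle, mul_left_comm, monomial_mul, mul_one, MvPolynomial.smul_eq_C_mul]
  simp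

open Classical in
/-- On an element `x^(m - m_U) e_U` of multidegree `m`, the cone construction with apex the least
generator dividing `m`. -/
noncomputable def coneMonomial (U : Finset (MinGen I)) (m : V →₀ ℕ) : Taylor I :=
  if h : ∃ q, IsLeast {q : MinGen I | q.exponent ≤ m} q then
    if h.choose ∈ U then 0 else taylorMonomial (insert h.choose U) m
  else 0

lemma coneMonomial_eq {U : Finset (MinGen I)} {m : V →₀ ℕ} {q : MinGen I}
    (hq : IsLeast {q : MinGen I | q.exponent ≤ m} q) :
    coneMonomial U m = if q ∈ U then 0 else taylorMonomial (insert q U) m := by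
  have h : ∃ q, IsLeast {q : MinGen I | q.exponent ≤ m} q := ⟨q, hq⟩
  have e : h.choose = q := h.choose_spec.unique hq
  rw [coneMonomial, dif_pos h, e]

variable (I) in
/-- The `K`-linear contraction of the Taylor resolution which in multidegree `m` is the cone with
apex the least generator dividing `m`. -/
noncomputable def taylorCone : Taylor I →ₗ[K] Taylor I :=
  -- The element `x^m e_U` has multidegree `m + m_U`, hence the shift.
  Finsupp.lsum K fun U => (basisMonomials V K).constr K fun m => coneMonomial U (m + lcmExp U)

lemma taylorCone_taylorMonomial {U : Finset (MinGen I)} {m : V →₀ ℕ} (h : lcmExp U ≤ m) :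
    taylorCone I (taylorMonomial U m) = coneMonomial U m := by
  have := (basisMonomials V K).constr_basis K
    (fun m => coneMonomial U (m + lcmExp U)) (m - lcmExp U)
  rw [coe_basisMonomials] at this
  rw [taylorCone, taylorMonomial, Finsupp.lsum_single, this, tsub_add_cancel_of_le h]

/-- Since `q` precedes all of `U`, deleting `q` has sign `+1`, and inserting it flips every other
sign. If `q ∈ U`, only the face without `q` survives coning, and it returns `U`; if `q ∉ U`, all
terms but `U` cancel in pairs. -/
lemma taylorMonomial_homotopy {U : Finset (MinGen I)} {m : V →₀ ℕ} {q : MinGen I}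
    (h : lcmExp U ≤ m) (hq : IsLeast {q : MinGen I | q.exponent ≤ m} q) :
    taylorD I (taylorCone I (taylorMonomial U m)) + taylorCone I (taylorD I (taylorMonomial U m))
      = taylorMonomial U m := by
  have hle : ∀ u ∈ U, q ≤ u := fun u hu => hq.2 ((MinGen.exponent_le_lcmExp hu).trans h)
  have herase : ∀ u, lcmExp (U.erase u) ≤ m :=
    fun u => (lcmExp_mono (Finset.erase_subset _ _)).trans h
  have hcone : ∀ u, taylorCone I (taylorMonomial (U.erase u) m) =
      if q ∈ U.erase u then 0 else taylorMonomial (insert q (U.erase u)) m :=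
    fun u => by rw [taylorCone_taylorMonomial (herase u), coneMonomial_eq hq]
  rw [taylorCone_taylorMonomial h, coneMonomial_eq hq, taylorD_taylorMonomial h, map_sum]
  simp only [map_smul, hcone]
  by_cases hqU : q ∈ U
  · rw [if_pos hqU, map_zero, zero_add, Finset.sum_eq_single_of_mem q hqU]
    · have : U.filter (fun v => v < q) = ∅ :=
        Finset.filter_eq_empty_iff.2 fun v hv => (hle v hv).not_gt
      simp [this, Finset.insert_erase hqU]
    · intro u _ huq
      rw [if_pos (Finset.mem_erase.2 ⟨huq.symm, hqU⟩), smul_zero]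
  · have hins : lcmExp (insert q U) ≤ m := by
      rw [lcmExp, Finset.sup_insert]
      exact sup_le hq.1 h
    have hlt : ∀ u ∈ U, q < u := fun u hu => (hle u hu).lt_of_ne (fun e => hqU (e ▸ hu))
    rw [if_neg hqU, taylorD_taylorMonomial hins, Finset.sum_insert hqU, Finset.erase_insert hqU]
    have : (insert q U).filter (fun v => v < q) = ∅ := by
      refine Finset.filter_eq_empty_iff.2 fun v hv => ?_
      rcases Finset.mem_insert.1 hv with rfl | hv
      · exact lt_irrefl _
      · exact (hle v hv).not_gt
    rw [this, Finset.card_empty, pow_zero, one_smul, add_assoc, ← Finset.sum_add_distrib,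
      Finset.sum_eq_zero, add_zero]
    intro u hu
    have hq' : q ∉ U.filter (fun v => v < u) := fun h => hqU (Finset.mem_filter.1 h).1
    rw [if_neg (fun h => hqU (Finset.mem_of_mem_erase h)), Finset.filter_insert, if_pos (hlt u hu),
      Finset.card_insert_of_notMem hq', Finset.erase_insert_of_ne (hlt u hu).ne, pow_succ]
    simp

/-- Any generator dividing the lcm of a tail divides `x^m`, so it is at least `q`. This leaves
nothing to check at `t = q`, and for `t > q` the tail does not contain `q`, so the condition is that
of `U`. -/
lemma LyubeznikAdmissible.insert_isLeast {U : Finset (MinGen I)} {m : V →₀ ℕ} {q : MinGen I}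
    (hU : LyubeznikAdmissible U) (h : lcmExp U ≤ m)
    (hq : IsLeast {q : MinGen I | q.exponent ≤ m} q) : LyubeznikAdmissible (insert q U) := by
  have hins : lcmExp (insert q U) ≤ m := by
    rw [lcmExp, Finset.sup_insert]
    exact sup_le hq.1 h
  have hle : ∀ u ∈ U, q ≤ u := fun u hu => hq.2 ((MinGen.exponent_le_lcmExp hu).trans h)
  rintro t ht ⟨s, hs, hts⟩ p hpt hp
  have hqp : q ≤ p := hq.2 (hp.trans ((lcmExp_mono (Finset.filter_subset _ _)).trans hins))
  have hqt : q < t := hqp.trans_lt hpt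
  have mem : ∀ {v}, v ∈ insert q U → q < v → v ∈ U := fun hv hqv =>
    (Finset.mem_insert.1 hv).resolve_left hqv.ne'
  rw [Finset.filter_insert, if_neg hqt.not_ge] at hp
  exact hU t (mem ht hqt) ⟨s, mem hs (hqt.trans hts), hts⟩ p hpt hp

lemma lyubeznikModule_eq_supported (n : ℕ) :
    lyubeznikModule I n = Finsupp.supported (MvPolynomial V K) (MvPolynomial V K)
      {U : Finset (MinGen I) | U.card = n ∧ LyubeznikAdmissible U} :=
  (Finsupp.supported_eq_span_single _ _).symm

lemma single_mem_lyubeznikModule {U : Finset (MinGen I)} (hU : LyubeznikAdmissible U)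
    (p : MvPolynomial V K) : Finsupp.single U p ∈ lyubeznikModule I U.card := by
  rw [lyubeznikModule_eq_supported]
  exact Finsupp.single_mem_supported _ _ ⟨rfl, hU⟩

lemma coneMonomial_mem {U : Finset (MinGen I)} {m : V →₀ ℕ} (hU : LyubeznikAdmissible U)
    (h : lcmExp U ≤ m) : coneMonomial U m ∈ lyubeznikModule I (U.card + 1) := by
  by_cases hq : ∃ q, IsLeast {q : MinGen I | q.exponent ≤ m} q
  · obtain ⟨q, hq⟩ := hq
    rw [coneMonomial_eq hq]
    split_ifs with hqU
    · exact zero_mem _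
    · rw [← Finset.card_insert_of_notMem hqU]
      exact single_mem_lyubeznikModule (hU.insert_isLeast h hq) _
  · rw [coneMonomial, dif_neg hq]
    exact zero_mem _

lemma taylorCone_mem {n : ℕ} {z : Taylor I} (hz : z ∈ lyubeznikModule I n) :
    taylorCone I z ∈ lyubeznikModule I (n + 1) := by
  rw [lyubeznikModule_eq_supported, Finsupp.mem_supported] at hz
  rw [← Finsupp.sum_single z, Finsupp.sum, map_sum]
  refine Submodule.sum_mem _ fun U hU => ?_
  obtain ⟨rfl, hU⟩ := hz hU
  rw [single_eq_sum_taylorMonomial, map_sum]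
  refine Submodule.sum_mem _ fun m _ => ?_
  rw [map_smul, taylorCone_taylorMonomial (le_add_self)]
  exact Submodule.smul_of_tower_mem _ _ (coneMonomial_mem hU (le_add_self))

/-- The cone needs a generator dividing the multidegree. A nonempty `U` provides one; the hypothesis
provides it for `U = ∅`. -/
lemma taylor_homotopy [Finite (MinGen I)] {z : Taylor I}
    (hz : ∀ m ∈ (z ∅).support, monomial m (1 : K) ∈ I) :
    taylorD I (taylorCone I z) + taylorCone I (taylorD I z) = z := by
  have key : ∀ U ∈ z.support,
      taylorD I (taylorCone I (Finsupp.single U (z U)))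
        + taylorCone I (taylorD I (Finsupp.single U (z U))) = Finsupp.single U (z U) := by
    intro U _
    rw [single_eq_sum_taylorMonomial]
    simp only [map_sum, map_smul, LinearMap.map_smul_of_tower]
    rw [← Finset.sum_add_distrib]
    refine Finset.sum_congr rfl fun m hm => ?_
    have hne : ({q : MinGen I | q.exponent ≤ m + lcmExp U}).Nonempty := by
      rcases U.eq_empty_or_nonempty with rfl | ⟨u, hu⟩
      · obtain ⟨q, hq⟩ := exists_minGen_le (hz m hm)
        exact ⟨q, hq.trans (le_self_add)⟩
      · exact ⟨u, (MinGen.exponent_le_lcmExp hu).trans (le_add_self)⟩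
    obtain ⟨q, hq⟩ := (Set.toFinite _).exists_minimal hne
    have hq' : IsLeast {q : MinGen I | q.exponent ≤ m + lcmExp U} q :=
      ⟨hq.1, fun p hp => le_of_not_gt fun hlt => hlt.not_ge (hq.2 hp hlt.le)⟩
    rw [← smul_add, taylorMonomial_homotopy (le_add_self) hq']
  conv_rhs => rw [← Finsupp.sum_single z]
  conv_lhs => rw [← Finsupp.sum_single z]
  simp only [Finsupp.sum, map_sum]
  rw [← Finset.sum_add_distrib]
  exact Finset.sum_congr rfl key

end Homotopy

/-! ### From the homotopy to a resolution, and the criterion for minimality. -/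

section Resolution

variable {V K : Type*} [Field K] {I : Ideal (MvPolynomial V K)} [LinearOrder (MinGen I)]

lemma lyubeznikComplex_d (n : ℕ) :
    (lyubeznikComplex I).d (n + 1) n = ModuleCat.ofHom (lyubeznikD I n) :=
  ChainComplex.of_d (fun n => ModuleCat.of (MvPolynomial V K) (lyubeznikModule I n))
    (fun n => ModuleCat.ofHom (lyubeznikD I n)) n

lemma lyubeznikD_coe (n : ℕ) (z : lyubeznikModule I (n + 1)) :
    (lyubeznikD I n z : Taylor I) = taylorD I z := rfl

lemma lyubeznikModule_apply_empty {n : ℕ} {z : Taylor I} (hz : z ∈ lyubeznikModule I (n + 1)) :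
    z ∅ = 0 := by
  rw [lyubeznikModule_eq_supported, Finsupp.mem_supported'] at hz
  exact hz ∅ (by simp)

lemma eq_single_of_mem_lyubeznikModule_zero {z : Taylor I} (hz : z ∈ lyubeznikModule I 0) :
    z = Finsupp.single ∅ (z ∅) := by
  rw [lyubeznikModule_eq_supported, Finsupp.mem_supported'] at hz
  ext1 U
  by_cases hU : U = ∅
  · subst hU
    simp
  · rw [Finsupp.single_eq_of_ne hU]
    exact hz U fun h => hU (Finset.card_eq_zero.1 h.1)

lemma lyubeznikD_exact [Finite (MinGen I)] (n : ℕ) :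
    Function.Exact (lyubeznikD I (n + 1)) (lyubeznikD I n) := by
  intro z
  constructor
  · intro h
    have h0 : taylorD I z = 0 := by rw [← lyubeznikD_coe, h]; rfl
    refine ⟨⟨taylorCone I z, taylorCone_mem z.2⟩, Subtype.ext ?_⟩
    have := taylor_homotopy (z := (z : Taylor I)) (by simp [lyubeznikModule_apply_empty z.2])
    rwa [h0, map_zero, add_zero] at this
  · rintro ⟨w, rfl⟩
    exact Subtype.ext (taylorD_taylorD I w.1)

variable (I) in
/-- The augmentation of the Lyubeznik resolution onto `K[V] / I`, sending `e_∅` to `1`. -/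
noncomputable def lyubeznikAugmentation :
    lyubeznikModule I 0 →ₗ[MvPolynomial V K] (MvPolynomial V K ⧸ I) :=
  Submodule.mkQ I ∘ₗ Finsupp.lapply ∅ ∘ₗ (lyubeznikModule I 0).subtype

lemma lyubeznikAugmentation_apply (z : lyubeznikModule I 0) :
    lyubeznikAugmentation I z = Ideal.Quotient.mk I ((z : Taylor I) ∅) := rfl

lemma admissible_empty : LyubeznikAdmissible (∅ : Finset (MinGen I)) := fun t ht => by simp at ht

lemma lyubeznikAugmentation_surjective : Function.Surjective (lyubeznikAugmentation I) := by
  intro q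
  obtain ⟨p, rfl⟩ := Ideal.Quotient.mk_surjective q
  refine ⟨⟨Finsupp.single ∅ p, single_mem_lyubeznikModule admissible_empty p⟩, ?_⟩
  rw [lyubeznikAugmentation_apply]
  simp

/-- Only singletons `{u}` have `∅` as a face, with coefficient the generator `u` itself. -/
lemma taylorD_apply_empty_mem (z : Taylor I) : taylorD I z ∅ ∈ I := by
  induction z using Finsupp.induction_linear with
  | zero => simp
  | add f g hf hg => rw [map_add, Finsupp.add_apply]; exact add_mem hf hg
  | single U p =>
    rw [taylorD_single, Finsupp.smul_apply, Finsupp.finsetSum_apply]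
    refine Submodule.smul_mem _ _ (Submodule.sum_mem _ fun u hu => ?_)
    rw [Finsupp.single_apply]
    split_ifs with h
    · have hU : U = {u} := ((Finset.erase_eq_empty_iff U u).1 h).resolve_left
        (Finset.ne_empty_of_mem hu)
      subst hU
      rw [taylorCoeff]
      refine Ideal.mul_mem_left _ _ ?_
      have h0 : lcmExp ({u} : Finset (MinGen I)) - lcmExp (({u} : Finset (MinGen I)).erase u)
          = u.exponent := by
        rw [Finset.erase_singleton, lcmExp, lcmExp, Finset.sup_singleton, Finset.sup_empty,
          bot_eq_zero, tsub_zero]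
      rw [h0]
      exact u.minimal.1
    · exact zero_mem _

lemma lyubeznikAugmentation_exact [Finite (MinGen I)]
    (hI : ∀ p ∈ I, ∀ m ∈ p.support, monomial m (1 : K) ∈ I) :
    Function.Exact (lyubeznikD I 0) (lyubeznikAugmentation I) := by
  intro z
  rw [lyubeznikAugmentation_apply, Ideal.Quotient.eq_zero_iff_mem]
  constructor
  · intro h
    have h0 : taylorD I (z : Taylor I) = 0 := by
      rw [eq_single_of_mem_lyubeznikModule_zero z.2, taylorD_single, Finset.sum_empty, smul_zero]
    refine ⟨⟨taylorCone I z, taylorCone_mem z.2⟩, Subtype.ext ?_⟩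
    have := taylor_homotopy (z := (z : Taylor I)) (hI _ h)
    rwa [h0, map_zero, add_zero] at this
  · rintro ⟨w, rfl⟩
    exact taylorD_apply_empty_mem _

variable (I) in
/-- The basis of the `n`-th Lyubeznik module given by the `e_U` with `U` admissible. -/
noncomputable def lyubeznikBasis (n : ℕ) :
    Module.Basis {U : Finset (MinGen I) | U.card = n ∧ LyubeznikAdmissible U} (MvPolynomial V K)
      (lyubeznikModule I n) :=
  .ofRepr ((LinearEquiv.ofEq _ _ (lyubeznikModule_eq_supported n)).trans
    (Finsupp.supportedEquivFinsupp _))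

lemma lyubeznikBasis_repr_apply (n : ℕ) (z : lyubeznikModule I n)
    (U : {U : Finset (MinGen I) | U.card = n ∧ LyubeznikAdmissible U}) :
    (lyubeznikBasis I n).repr z U = (z : Taylor I) U := rfl

lemma lyubeznikBasis_coe (n : ℕ)
    (U : {U : Finset (MinGen I) | U.card = n ∧ LyubeznikAdmissible U}) :
    (lyubeznikBasis I n U : Taylor I) = Finsupp.single (U : Finset (MinGen I)) 1 := by
  have h : (⟨Finsupp.single (U : Finset (MinGen I)) 1, Submodule.subset_span ⟨_, U.2, rfl⟩⟩ :
      lyubeznikModule I n) = lyubeznikBasis I n U := by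
    refine (lyubeznikBasis I n).repr.injective (Finsupp.ext fun W => ?_)
    rw [Module.Basis.repr_self, lyubeznikBasis_repr_apply]
    simp only [Finsupp.single_apply, Subtype.ext_iff]
  rw [← h]

lemma degree_add_of_mem_support_taylorD {U W : Finset (MinGen I)} {m : V →₀ ℕ}
    (hm : m ∈ (taylorD I (Finsupp.single U 1) W).support) :
    m.degree + (lcmExp W).degree = (lcmExp U).degree := by
  rw [taylorD_single, one_smul, Finsupp.finsetSum_apply] at hm
  classical
  obtain ⟨u, _, hu⟩ := Finset.mem_biUnion.1 (support_sum hm)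
  clear hm
  rw [Finsupp.single_apply] at hu
  split_ifs at hu with h
  · subst h
    have h1 : taylorCoeff U u = C ((-1) ^ (U.filter (fun v => v < u)).card) *
        monomial (lcmExp U - lcmExp (U.erase u)) (1 : K) := by simp [taylorCoeff]
    rw [h1, C_mul_monomial] at hu
    rw [Finset.mem_singleton.1 (support_monomial_subset hu), ← map_add,
      tsub_add_cancel_of_le (lcmExp_mono (Finset.erase_subset _ _))]
  · simp at hu

lemma monomial_mem_span_X {m : V →₀ ℕ} (hm : m ≠ 0) :
    monomial m (1 : K) ∈ Ideal.span (Set.range (X : V → MvPolynomial V K)) := by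
  obtain ⟨v, hv⟩ := Finsupp.ne_iff.1 hm
  refine Ideal.mem_of_dvd _ ?_ (Ideal.subset_span ⟨v, rfl⟩)
  exact X_dvd_monomial.2 (Or.inr hv)

lemma lyubeznikD_mem_smul_top
    (hmin : ∀ U : Finset (MinGen I), LyubeznikAdmissible U → ∀ u ∈ U,
      lcmExp (U.erase u) ≠ lcmExp U) (n : ℕ) (z : lyubeznikModule I (n + 1)) :
    lyubeznikD I n z ∈ Ideal.span (Set.range (X : V → MvPolynomial V K)) •
      (⊤ : Submodule (MvPolynomial V K) (lyubeznikModule I n)) := by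
  set J := Ideal.span (Set.range (X : V → MvPolynomial V K))
  suffices h : ⊤ ≤ (J • (⊤ : Submodule (MvPolynomial V K) (lyubeznikModule I n))).comap
      (lyubeznikD I n) from h Submodule.mem_top
  rw [← (lyubeznikBasis I (n + 1)).span_eq, Submodule.span_le]
  rintro _ ⟨⟨U, hc, hU⟩, rfl⟩
  have hmem : ∀ u ∈ U, Finsupp.single (U.erase u) 1 ∈ lyubeznikModule I n := fun u hu =>
    Submodule.subset_span ⟨_, ⟨by rw [Finset.card_erase_of_mem hu, hc, Nat.add_sub_cancel],
      hU.subset (Finset.erase_subset _ _)⟩, rfl⟩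
  have hd : lyubeznikD I n (lyubeznikBasis I (n + 1) ⟨U, hc, hU⟩) =
      ∑ u : U, taylorCoeff U u.1 • (⟨_, hmem u u.2⟩ : lyubeznikModule I n) := by
    refine Subtype.ext ?_
    rw [lyubeznikD_coe, lyubeznikBasis_coe, taylorD_single, one_smul, Submodule.coe_sum,
      ← Finset.sum_coe_sort]
    simp
  rw [SetLike.mem_coe, Submodule.mem_comap, hd]
  refine Submodule.sum_mem _ fun u _ => Submodule.smul_mem_smul ?_ Submodule.mem_top
  refine Ideal.mul_mem_left _ _ (monomial_mem_span_X fun h => hmin U hU u u.2 ?_)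
  exact le_antisymm (lcmExp_mono (Finset.erase_subset _ _)) (tsub_eq_zero_iff_le.1 h)

/-- `hI` says that `I` is a monomial ideal; `hmin` makes each coefficient `m_U / m_{U \ u}` a
nonconstant monomial. The basis element `e_U` has degree `deg m_U`. -/
theorem lyubeznikComplex_isMinimalFreeResolution [Finite (MinGen I)]
    (hI : ∀ p ∈ I, ∀ m ∈ p.support, monomial m (1 : K) ∈ I)
    (hmin : ∀ U : Finset (MinGen I), LyubeznikAdmissible U → ∀ u ∈ U,
      lcmExp (U.erase u) ≠ lcmExp U) :
    IsMinimalFreeResolution (lyubeznikComplex I) I where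
  exact n := by
    rw [lyubeznikComplex_d, lyubeznikComplex_d]
    exact lyubeznikD_exact n
  free := by
    have e : ∀ n, Nonempty (Σ r : ℕ,
        {U : Finset (MinGen I) | U.card = n ∧ LyubeznikAdmissible U} ≃ Fin r) := fun n =>
      ⟨_, Finite.equivFin _⟩
    replace e := fun n => (e n).some
    refine ⟨fun n => (e n).1, fun n => (lyubeznikBasis I n).reindex (e n).2,
      fun n i => (lcmExp ((e n).2.symm i : Finset (MinGen I))).degree,
      lyubeznikAugmentation I, lyubeznikAugmentation_surjective, ?_, ?_, ?_⟩
    · rw [lyubeznikComplex_d]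
      exact lyubeznikAugmentation_exact hI
    · intro i
      have h : (((e 0).2.symm i : _) : Finset (MinGen I)) = ∅ :=
        Finset.card_eq_zero.1 ((e 0).2.symm i).2.1
      refine ⟨1, ?_, ?_⟩
      · have h0 : (1 : MvPolynomial V K).IsHomogeneous
            (lcmExp ((e 0).2.symm i : Finset (MinGen I))).degree := by
          rw [h, lcmExp, Finset.sup_empty, bot_eq_zero, map_zero]
          exact isHomogeneous_one V K
        exact h0
      · have h1 : lyubeznikAugmentation I ((lyubeznikBasis I 0).reindex (e 0).2 i)
            = Ideal.Quotient.mk I 1 := by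
          rw [Module.Basis.reindex_apply, lyubeznikAugmentation_apply, lyubeznikBasis_coe, h,
            Finsupp.single_eq_same]
        exact h1
    · intro n j i m hm
      rw [lyubeznikComplex_d] at hm
      replace hm : m ∈ (((lyubeznikBasis I n).reindex (e n).2).repr
        (lyubeznikD I n ((lyubeznikBasis I (n + 1)).reindex (e (n + 1)).2 j)) i).support := hm
      rw [Module.Basis.reindex_apply, Module.Basis.repr_reindex_apply, lyubeznikBasis_repr_apply,
        lyubeznikD_coe, lyubeznikBasis_coe] at hm
      exact degree_add_of_mem_support_taylorD hm
  minimal n z := by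
    rw [lyubeznikComplex_d]
    exact lyubeznikD_mem_smul_top hmin n z

end Resolution

/-! ### Monomials and minimal generators of edge ideals. -/

section EdgeIdeal

variable {V K : Type*} [Field K]

lemma edgeIdeal_eq_span_monomial (G : SimpleGraph V) :
    edgeIdeal K G = Ideal.span ((fun m => monomial m (1 : K)) ''
      {m | ∃ v w, G.Adj v w ∧ m = Finsupp.single v 1 + Finsupp.single w 1}) := by
  rw [edgeIdeal]
  congr 1
  ext p
  simp only [Set.mem_ofPred_eq, Set.mem_image]
  constructor
  · rintro ⟨v, w, h, rfl⟩
    exact ⟨_, ⟨v, w, h, rfl⟩, by simp [X, monomial_mul]⟩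
  · rintro ⟨_, ⟨v, w, h, rfl⟩, rfl⟩
    exact ⟨v, w, h, by simp [X, monomial_mul]⟩

lemma monomial_mem_edgeIdeal_iff (G : SimpleGraph V) (m : V →₀ ℕ) :
    monomial m (1 : K) ∈ edgeIdeal K G ↔
      ∃ v w, G.Adj v w ∧ Finsupp.single v 1 + Finsupp.single w 1 ≤ m := by
  classical
  rw [edgeIdeal_eq_span_monomial, mem_ideal_span_monomial_image, support_monomial,
    if_neg one_ne_zero]
  simp only [Finset.mem_singleton, forall_eq, Set.mem_ofPred_eq]
  constructor
  · rintro ⟨_, ⟨v, w, h, rfl⟩, hle⟩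
    exact ⟨v, w, h, hle⟩
  · rintro ⟨v, w, h, hle⟩
    exact ⟨_, ⟨v, w, h, rfl⟩, hle⟩

lemma monomial_mem_edgeIdeal_of_mem_support (G : SimpleGraph V) {p : MvPolynomial V K}
    (hp : p ∈ edgeIdeal K G) {m : V →₀ ℕ} (hm : m ∈ p.support) :
    monomial m (1 : K) ∈ edgeIdeal K G := by
  rw [edgeIdeal_eq_span_monomial, mem_ideal_span_monomial_image] at hp
  obtain ⟨_, ⟨v, w, h, rfl⟩, hle⟩ := hp m hm
  exact (monomial_mem_edgeIdeal_iff G m).2 ⟨v, w, h, hle⟩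

lemma MinGen.exists_adj {G : SimpleGraph V} (u : MinGen (edgeIdeal K G)) :
    ∃ v w, G.Adj v w ∧ u.exponent = Finsupp.single v 1 + Finsupp.single w 1 := by
  obtain ⟨v, w, h, hle⟩ := (monomial_mem_edgeIdeal_iff G u.exponent).1 u.minimal.1
  exact ⟨v, w, h, le_antisymm
    (u.minimal.2 ((monomial_mem_edgeIdeal_iff G _).2 ⟨v, w, h, le_rfl⟩) hle) hle⟩

instance MinGen.finite_of_edgeIdeal [Finite V] (G : SimpleGraph V) :
    Finite (MinGen (edgeIdeal K G)) := by
  choose v w _ h using fun u : MinGen (edgeIdeal K G) => u.exists_adj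
  refine Finite.of_injective (fun u => (v u, w u)) fun u u' e => MinGen.ext ?_
  obtain ⟨e₁, e₂⟩ := Prod.mk.inj e
  rw [h, h, e₁, e₂]

end EdgeIdeal

/-! ### Edges of `L(a,b,c)`. -/

section LGraph

variable {a b c : ℕ}

instance LVertex.finite : Finite (LVertex a b c) := by
  refine Finite.of_injective (β := Bool ⊕ Fin a ⊕ Fin b ⊕ Fin c)
    (fun
      | .x => .inl true
      | .y => .inl false
      | .xs i => .inr (.inl i)
      | .ys j => .inr (.inr (.inl j))
      | .zs k => .inr (.inr (.inr k))) ?_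
  rintro (_ | _ | _ | _ | _) (_ | _ | _ | _ | _) h <;> simp_all

/-- The edge `{x,y}` is dominating: every other edge joins `x` or `y` to a third vertex. -/
lemma LGraph_adj_cases {v w : LVertex a b c} (h : (LGraph a b c).Adj v w) :
    s(v, w) = s(LVertex.x, LVertex.y) ∨
      ∃ t, t ≠ LVertex.x ∧ t ≠ LVertex.y ∧
        (s(v, w) = s(LVertex.x, t) ∨ s(v, w) = s(LVertex.y, t)) := by
  rw [LGraph, SimpleGraph.fromEdgeSet_adj] at h
  rcases h.1 with (((h | ⟨i, h⟩) | ⟨i, h⟩) | ⟨i, h⟩) | ⟨i, h⟩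
  · exact Or.inl h
  · exact Or.inr ⟨_, by simp, by simp, Or.inl h.symm⟩
  · exact Or.inr ⟨_, by simp, by simp, Or.inr h.symm⟩
  · exact Or.inr ⟨_, by simp, by simp, Or.inl h.symm⟩
  · exact Or.inr ⟨_, by simp, by simp, Or.inr h.symm⟩

end LGraph

/-! ### Irredundancy of admissible sets. -/

section Minimality

variable {V K : Type*} [Field K] {I : Ideal (MvPolynomial V K)}

lemma lcmExp_apply_eq_zero {U : Finset (MinGen I)} {v : V} (h : ∀ u ∈ U, u.exponent v = 0) :
    lcmExp U v = 0 := by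
  classical
  induction U using Finset.induction_on with
  | empty => rw [lcmExp, Finset.sup_empty, bot_eq_zero, Finsupp.zero_apply]
  | insert u U _ ih =>
    rw [lcmExp, Finset.sup_insert, Finsupp.sup_apply, h u (Finset.mem_insert_self _ _)]
    exact (max_eq_right (Nat.zero_le _)).trans (ih fun u hu => h u (Finset.mem_insert_of_mem hu))

variable [LinearOrder (MinGen I)]

/-- Apply admissibility at the least `t` of `U \ u₀` with `q = u₀`: the tail from `t` is all of `U \
u₀`. If `t` is the maximum of `U`, admissibility is silent there, but then `U \ u₀ = {t}`, and
distinct minimal generators do not divide each other. -/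
lemma LyubeznikAdmissible.not_exponent_le_lcmExp_erase {U : Finset (MinGen I)}
    (hU : LyubeznikAdmissible U) {u₀ : MinGen I} (hleast : ∀ u, u₀ ≤ u)
    (h0 : u₀.exponent ≠ 0) : ¬ u₀.exponent ≤ lcmExp (U.erase u₀) := by
  intro hle
  rcases (U.erase u₀).eq_empty_or_nonempty with he | hne
  · rw [he, lcmExp, Finset.sup_empty, bot_eq_zero] at hle
    exact h0 (le_antisymm hle bot_le)
  · set t := (U.erase u₀).min' hne
    have ht : t ∈ U.erase u₀ := Finset.min'_mem _ _
    have hlt : u₀ < t := (hleast t).lt_of_ne (Finset.ne_of_mem_erase ht).symm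
    have htv : ∀ v ∈ U.erase u₀, t ≤ v := fun v hv => Finset.min'_le _ _ hv
    by_cases hs : ∃ s ∈ U, t < s
    · refine hU t (Finset.mem_of_mem_erase ht) hs u₀ hlt (hle.trans (lcmExp_mono fun v hv => ?_))
      exact Finset.mem_filter.2 ⟨Finset.mem_of_mem_erase hv, htv v hv⟩
    · push Not at hs
      have : U.erase u₀ = {t} := Finset.eq_singleton_iff_unique_mem.2
        ⟨ht, fun v hv => le_antisymm (hs v (Finset.mem_of_mem_erase hv)) (htv v hv)⟩
      rw [this, lcmExp, Finset.sup_singleton, MinGen.exponent_le_iff] at hle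
      exact hlt.ne hle

/-- If every generator other than the least one `xy` is of the form `xt` or `yt` for a further
variable `t`, then admissible sets are irredundant. -/
lemma LyubeznikAdmissible.lcmExp_erase_ne {x y : V} (hne : x ≠ y) {u₀ : MinGen I}
    (hleast : ∀ u, u₀ ≤ u) (hxy : u₀.exponent = Finsupp.single x 1 + Finsupp.single y 1)
    (hgen : ∀ u, u ≠ u₀ → ∃ t, t ≠ x ∧ t ≠ y ∧
      (u.exponent = Finsupp.single x 1 + Finsupp.single t 1 ∨
        u.exponent = Finsupp.single y 1 + Finsupp.single t 1))
    {U : Finset (MinGen I)} (hU : LyubeznikAdmissible U) {u : MinGen I} (hu : u ∈ U) :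
    lcmExp (U.erase u) ≠ lcmExp U := by
  intro heq
  have h0 : u₀.exponent ≠ 0 := fun h => by
    have := DFunLike.congr_fun (hxy.symm.trans h) x
    simp at this
  have hnot := hU.not_exponent_le_lcmExp_erase hleast h0
  by_cases huu : u = u₀
  · subst huu
    exact hnot (heq ▸ MinGen.exponent_le_lcmExp hu)
  -- A member divisible by `x` together with one divisible by `y` would make `xy` divide the lcm.
  have hcross : ∀ v ∈ U.erase u₀, ∀ w ∈ U.erase u₀, v.exponent x ≠ 0 → w.exponent y = 0 := by
    intro v hv w hw hvx
    by_contra hwy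
    refine hnot ?_
    rw [hxy]
    intro i
    have h1 := MinGen.exponent_le_lcmExp hv i
    have h2 := MinGen.exponent_le_lcmExp hw i
    classical
    simp only [Finsupp.add_apply, Finsupp.single_apply]
    split_ifs with hx hy hy
    · exact absurd (hx.trans hy.symm) hne
    · subst hx; omega
    · subst hy; omega
    · omega
  have hu' : u ∈ U.erase u₀ := Finset.mem_erase.2 ⟨huu, hu⟩
  obtain ⟨t, htx, hty, ht⟩ := hgen u huu
  have htu : u.exponent t ≠ 0 := by rcases ht with ht | ht <;> simp [ht]
  -- The variable `t` divides no other member: a second one would be `u` again, or would pair `xt`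
  -- with `yt`, against `hcross`.
  have hz : lcmExp (U.erase u) t = 0 := by
    refine lcmExp_apply_eq_zero fun v hv => ?_
    by_cases hv0 : v = u₀
    · rw [hv0, hxy]
      simp [htx, hty]
    have hv' : v ∈ U.erase u₀ := Finset.mem_erase.2 ⟨hv0, Finset.mem_of_mem_erase hv⟩
    obtain ⟨s, hsx, hsy, hs⟩ := hgen v hv0
    have hst : t ≠ s := by
      rintro rfl
      have hvu : v ≠ u := Finset.ne_of_mem_erase hv
      rcases ht with ht | ht <;> rcases hs with hs | hs
      · exact hvu (MinGen.ext (hs.trans ht.symm))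
      · exact absurd (hcross u hu' v hv' (by simp [ht])) (by simp [hs])
      · exact absurd (hcross v hv' u hu' (by simp [hs])) (by simp [ht])
      · exact hvu (MinGen.ext (hs.trans ht.symm))
    rcases hs with hs | hs <;> simp [hs, htx, hty, hst]
  rw [heq] at hz
  have := MinGen.exponent_le_lcmExp hu t
  omega

end Minimality

theorem theorem3p2 (K : Type*) [Field K] (a b c : ℕ)
    [LinearOrder (MinGen (edgeIdeal K (LGraph a b c)))]
    (u₀ : MinGen (edgeIdeal K (LGraph a b c)))
    (hxy : (monomial u₀.exponent (1 : K)) = X LVertex.x * X LVertex.y)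
    (hleast : ∀ u : MinGen (edgeIdeal K (LGraph a b c)), u₀ ≤ u) :
    IsMinimalFreeResolution (lyubeznikComplex (edgeIdeal K (LGraph a b c)))
      (edgeIdeal K (LGraph a b c)) := by
  have hu₀ : u₀.exponent = Finsupp.single LVertex.x 1 + Finsupp.single LVertex.y 1 := by
    rw [X, X, monomial_mul, one_mul] at hxy
    exact monomial_left_injective one_ne_zero hxy
  refine lyubeznikComplex_isMinimalFreeResolution
    (fun p hp m hm => monomial_mem_edgeIdeal_of_mem_support _ hp hm)
    fun U hU u hu => hU.lcmExp_erase_ne (by simp) hleast hu₀ (fun u hne => ?_) hu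
  obtain ⟨v, w, hadj, he⟩ := u.exists_adj
  have hsum : ∀ p q : LVertex a b c, s(v, w) = s(p, q) →
      u.exponent = Finsupp.single p 1 + Finsupp.single q 1 := by
    intro p q h
    rcases Sym2.eq_iff.1 h with ⟨rfl, rfl⟩ | ⟨rfl, rfl⟩
    · exact he
    · rw [he, add_comm]
  rcases LGraph_adj_cases hadj with h | ⟨t, htx, hty, h⟩
  · exact absurd (MinGen.ext ((hsum _ _ h).trans hu₀.symm)) hne
  · exact ⟨t, htx, hty, h.imp (hsum _ _) (hsum _ _)⟩
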